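/- A topological space is zero-dimensional if its clopen sets form a basis. A class $\Gamma$ of subsets of zero-dimensional Polish spaces is a *Wadge class (of Borel sets)* if there are a zero-dimensional Polish space $P_0$ and a Borel set $A_0\subseteq P_0$ such that, for every zero-dimensional Polish space $P$ and every $A\subseteq P$, one has $A\in\Gamma$ if and only if $A=f^{-1}(A_0)$ for some continuous $f:P\to P_0$. Let $\check\Gamma$ be the dual class (the sets whose complement is in $\Gamma$), and let $\Gamma^+$ be the successor of $\Gamma$, i.e. the least Wadge class strictly containing $\Gamma$. For $n\ge 1$, let $D_n(\boldsymbol\Sigma^0_1)$ be the class of the sets of the form $$\bigcup_{i<n,\ i\not\equiv n \ (\mathrm{mod}\ 2)} \Big(U_i\setminus\bigcup_{j<i}U_j\Big),\qquad U_0\subseteq U_1\subseteq\dots\subseteq U_{n-1}\ \text{open}.$$ If $X$ and $Y$ are Polish spaces and $A\subseteq X\times Y$, then $A$ is $\mathrm{pot}(\Gamma)$ (*potentially in* $\Gamma$) if there are zero-dimensional Polish topologies $\sigma$ on $X$ and $\tau$ on $Y$, finer than the given ones, such that $A$, as a subset of $(X,\sigma)\times(Y,\tau)$, is in $\Gamma$.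 **Corollary.** Let $X$ and $Y$ be Polish spaces, let $A\subseteq X\times Y$ be a Borel set all of whose vertical sections $\{y\in Y: (x,y)\in A\}$, $x\in X$, are countable, and let $k\ge 1$ be an integer. Then: (a) $A$ is not $\mathrm{pot}(\boldsymbol\Delta^0_1)$ $\Leftrightarrow$ $A$ is not $\mathrm{pot}(\boldsymbol\Sigma^0_1)$ $\Leftrightarrow$ the projection of $A$ on $Y$ is uncountable. (b) The class $D_{2k-1}(\boldsymbol\Sigma^0_1)^+$ exists, and $A$ is not $\mathrm{pot}(\check D_{2k-1}(\boldsymbol\Sigma^0_1))$ $\Leftrightarrow$ $A$ is not $\mathrm{pot}(\check D_{2k}(\boldsymbol\Sigma^0_1))$ $\Leftrightarrow$ $A$ is not $\mathrm{pot}(D_{2k-1}(\boldsymbol\Sigma^0_1)^+)$. (c) The class $D_{2k}(\boldsymbol\Sigma^0_1)^+$ exists, and $A$ is not $\mathrm{pot}(D_{2k+1}(\boldsymbol\Sigma^0_1))$ $\Leftrightarrow$ $A$ is not $\mathrm{pot}(D_{2k}(\boldsymbol\Sigma^0_1))$ $\Leftrightarrow$ $A$ is not $\mathrm{pot}(D_{2k}(\boldsymbol\Sigma^0_1)^+)$.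 -/

import Mathlib

universe u v w

/-- A topological space is zero-dimensional if its clopen sets form a basis. -/
def ZeroDimensional (P : Type w) (t : TopologicalSpace P) : Prop :=
  TopologicalSpace.IsTopologicalBasis {s : Set P | IsClopen s}

/-- A Polish topology of dimension zero. -/
def IsPolishZeroDim (P : Type w) (t : TopologicalSpace P) : Prop :=
  PolishSpace P ∧ ZeroDimensional P t

/-- A class of subsets of topological spaces. Only its members in zero-dimensional Polish spaces
are relevant. -/
abbrev PointClass : Type (w + 1) :=
  ∀ P : Type w, TopologicalSpace P → Set P → Prop

/-- Inclusion of classes of subsets of zero-dimensional Polish spaces. -/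
def PointClass.Incl (Γ Γ' : PointClass.{w}) : Prop :=
  ∀ (P : Type w) (t : TopologicalSpace P), IsPolishZeroDim P t →
    ∀ A : Set P, Γ P t A → Γ' P t A

/-- Strict inclusion of classes of subsets of zero-dimensional Polish spaces. -/
def PointClass.StrictIncl (Γ Γ' : PointClass.{w}) : Prop :=
  Γ.Incl Γ' ∧ ¬ Γ'.Incl Γ

/-- The dual class: the sets whose complement is in the class. -/
def PointClass.dual (Γ : PointClass.{w}) : PointClass.{w} :=
  fun P t A => Γ P t Aᶜ

/-- A Wadge class of Borel sets: the class of all continuous preimages, in zero-dimensional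
Polish spaces, of one Borel subset of one zero-dimensional Polish space. -/
def IsWadgeClass (Γ : PointClass.{w}) : Prop :=
  ∃ (P₀ : Type w) (t₀ : TopologicalSpace P₀) (A₀ : Set P₀),
    IsPolishZeroDim P₀ t₀ ∧ @MeasurableSet P₀ (borel P₀) A₀ ∧
      ∀ (P : Type w) (t : TopologicalSpace P), IsPolishZeroDim P t →
        ∀ A : Set P, Γ P t A ↔ ∃ f : P → P₀, Continuous f ∧ A = f ⁻¹' A₀

/-- `Γ'` is the successor of `Γ`: the least Wadge class of Borel sets strictly containing `Γ`. -/
def IsWadgeSucc (Γ Γ' : PointClass.{w}) : Prop :=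
  IsWadgeClass Γ' ∧ Γ.StrictIncl Γ' ∧
    ∀ Γ'' : PointClass.{w}, IsWadgeClass Γ'' → Γ.StrictIncl Γ'' → Γ'.Incl Γ''

/-- The successor class `Γ⁺`, given as the intersection of all the Wadge classes of Borel sets
that strictly contain `Γ`; if there is a least such class, then it is this one. -/
def PointClass.succ (Γ : PointClass.{w}) : PointClass.{w} :=
  fun P t A => ∀ Γ' : PointClass.{w}, IsWadgeClass Γ' → Γ.StrictIncl Γ' → Γ' P t A

/-- The class of open sets. -/
def Sigma01 : PointClass.{w} := fun _ _ A => IsOpen A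

/-- The class of clopen sets. -/
def Delta01 : PointClass.{w} := fun _ _ A => IsClopen A

/-- The class of differences of `n` open sets: for an increasing sequence of open sets
`U 0 ⊆ ⋯ ⊆ U (n - 1)`, the points whose least index `i` with `x ∈ U i` exists and
has parity opposite to that of `n`. -/
def DiffOpen (n : ℕ) : PointClass.{w} :=
  fun P _ A => ∃ U : Fin n → Set P, Monotone U ∧ (∀ i, IsOpen (U i)) ∧
    A = {x | ∃ i : Fin n, (i : ℕ) % 2 ≠ n % 2 ∧ x ∈ U i ∧ ∀ j < i, x ∉ U j}

/-- `A` is potentially in `Γ`: there are finer zero-dimensional Polish topologies on the two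
factors such that `A` is in `Γ` for the product of these topologies. -/
def Pot {X : Type u} {Y : Type v} [tX : TopologicalSpace X] [tY : TopologicalSpace Y]
    (Γ : PointClass.{max u v}) (A : Set (X × Y)) : Prop :=
  ∃ (σ : TopologicalSpace X) (τ : TopologicalSpace Y), σ ≤ tX ∧ τ ≤ tY ∧
    IsPolishZeroDim X σ ∧ IsPolishZeroDim Y τ ∧
      Γ (X × Y) (@instTopologicalSpaceProd X Y σ τ) A

/-! If an open subset of a product has countable vertical sections, each of its points lies over a
countable basic open subset of `Y`, so its projection on `Y` is countable. A Borel set with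
countable projection becomes clopen after refining both topologies. This gives (a).

For (b) and (c), parity places the innermost open set of a `D_{n+1}` description inside `A`:
describe `A` itself when `n` is even, its complement when `n` is odd. So that open set can be made
clopen. A clopen innermost layer merges with the third one, leaving a `D_n` description
(`pot_diffOpen_of_succ`). The successor of `D_n` contains `D_n` and its dual, and is contained in
`D_{n+1}` and its dual, so the three conditions coincide.

The successor is `DiffOpenJoin n`. A set outside `D_n` has a point surviving `n` alternation
derivatives, and near such a point every complement of a `D_n` set reduces to it
(`exists_continuous_preimage_eq`). Hence a Wadge class strictly above `D_n` contains the dual of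
`D_n`, and also the clopen gluings. -/

open Set Topology TopologicalSpace

/-! ### Refinements of Polish topologies -/

section Polish

variable {α : Type*}

lemma exists_polish_isClopen [t : TopologicalSpace α] [PolishSpace α] {S : Set (Set α)}
    (hS : S.Countable) (hB : ∀ s ∈ S, @MeasurableSet α (borel α) s) :
    ∃ t' : TopologicalSpace α, t' ≤ t ∧ @PolishSpace α t' ∧ ∀ s ∈ S, @IsClopen α t' s := by
  have : Countable S := hS
  have h : ∀ s : S, PolishSpace.IsClopenable (s : Set α) := fun s =>
    @MeasurableSet.isClopenable α t _ (borel α) (@BorelSpace.mk α t (borel α) rfl) _ (hB s s.2)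
  choose m hm hp hc ho using h
  obtain ⟨t', h1, h2, h3⟩ := PolishSpace.exists_polishSpace_forall_le m hm hp
  exact ⟨t', h2, h3, fun s hs =>
    ⟨(hc ⟨s, hs⟩).mono (h1 _), h1 ⟨s, hs⟩ s (ho ⟨s, hs⟩)⟩⟩

lemma zeroDimensional_of_generateFrom (t : TopologicalSpace α) (B : Set (Set α))
    (ht : t = generateFrom B) (hB : ∀ s ∈ B, @IsClopen α t s) : ZeroDimensional α t := by
  refine isTopologicalBasis_of_isOpen_of_nhds (fun s hs => hs.2) fun x U hx hU => ?_
  obtain ⟨V, ⟨f, ⟨hf, hfB⟩, rfl⟩, hxV, hVU⟩ :=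
    (isTopologicalBasis_of_subbasis ht).exists_subset_of_mem_open hx hU
  refine ⟨_, ?_, hxV, hVU⟩
  change IsClopen (⋂₀ f)
  rw [sInter_eq_biInter]
  exact hf.isClopen_biInter fun s hs => hB s (hfB hs)

/-- One refinement makes a countable basis clopen but creates new open sets. Iterating `ω` times and
joining the topologies closes off: the bases of all stages generate the join, and each is clopen one
stage later. -/
lemma exists_polishZeroDim_isClopen [t : TopologicalSpace α] [PolishSpace α] {S : Set (Set α)}
    (hS : S.Countable) (hB : ∀ s ∈ S, @MeasurableSet α (borel α) s) :
    ∃ t' : TopologicalSpace α, t' ≤ t ∧ IsPolishZeroDim α t' ∧ ∀ s ∈ S, @IsClopen α t' s := by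
  obtain ⟨t₀, h₀, hp₀, hc₀⟩ := exists_polish_isClopen hS hB
  have step : ∀ s : {s : TopologicalSpace α // @PolishSpace α s},
      ∃ s' : {s : TopologicalSpace α // @PolishSpace α s}, s'.1 ≤ s.1 ∧
        ∃ B : Set (Set α), s.1 = generateFrom B ∧ ∀ b ∈ B, @IsClopen α s'.1 b := by
    rintro ⟨s, hs⟩
    have hgen := (isBasis_countableBasis α).eq_generateFrom
    obtain ⟨s', h1, h2, h3⟩ := @exists_polish_isClopen α s hs (countableBasis α)
      (countable_countableBasis α) (fun b hb => MeasurableSpace.measurableSet_generateFrom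
        (isOpen_of_mem_countableBasis hb))
    exact ⟨⟨s', h2⟩, h1, _, hgen, h3⟩
  choose F hF B hFB hBc using step
  let T : ℕ → {s : TopologicalSpace α // @PolishSpace α s} := fun n => F^[n] ⟨t₀, hp₀⟩
  have hT : ∀ n, T (n + 1) = F (T n) := fun n => Function.iterate_succ_apply' F n _
  let t' : TopologicalSpace α := ⨅ n, (T n).1
  have hle : ∀ n, t' ≤ (T n).1 := fun n => iInf_le _ n
  have hmono : ∀ n, (T n).1 ≤ t₀ := by
    intro n
    induction n with
    | zero => exact le_rfl
    | succ n ih => rw [hT]; exact (hF _).trans ih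
  refine ⟨t', (hle 0).trans h₀, ⟨?_, ?_⟩, fun s hs => ?_⟩
  · exact PolishSpace.iInf ⟨0, hmono⟩ fun n => (T n).2
  · refine zeroDimensional_of_generateFrom t' (⋃ n, B (T n)) ?_ ?_
    · rw [generateFrom_iUnion]
      exact iInf_congr fun n => hFB _
    · rintro s hs
      obtain ⟨n, hn⟩ := mem_iUnion.1 hs
      have := hBc _ s hn
      rw [← hT] at this
      exact ⟨this.1.mono (hle _), hle (n + 1) s this.2⟩
  · exact ⟨(hc₀ s hs).1.mono (hle 0), hle 0 s (hc₀ s hs).2⟩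

lemma IsPolishZeroDim.prod {X Y : Type*} {σ : TopologicalSpace X} {τ : TopologicalSpace Y}
    (hX : IsPolishZeroDim X σ) (hY : IsPolishZeroDim Y τ) :
    IsPolishZeroDim (X × Y) inferInstance := by
  have := hX.1
  have := hY.1
  refine ⟨inferInstance, isTopologicalBasis_of_isOpen_of_nhds (fun s hs => hs.2) ?_⟩
  intro x U hx hU
  obtain ⟨V, hV, hxV, hVU⟩ := (hX.2.prod hY.2).exists_subset_of_mem_open hx hU
  obtain ⟨a, ha, b, hb, rfl⟩ := hV
  exact ⟨_, ha.prod hb, hxV, hVU⟩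

lemma isPolishZeroDim_uLift (Q : Type) [TopologicalSpace Q] [MetrizableSpace Q] [CompactSpace Q]
    [TotallyDisconnectedSpace Q] : IsPolishZeroDim (ULift.{w} Q) inferInstance := by
  have : PolishSpace Q := by
    let _ := metrizableSpaceMetric Q
    infer_instance
  refine ⟨(Homeomorph.ulift (X := Q)).isClosedEmbedding.polishSpace, ?_⟩
  have : TotallyDisconnectedSpace (ULift.{w} Q) :=
    (Homeomorph.ulift (X := Q)).symm.totallyDisconnectedSpace
  exact isTopologicalBasis_isClopen

/-- Every open set of a zero-dimensional Polish space is a union of a sequence of clopen sets. -/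
lemma IsPolishZeroDim.exists_iUnion_isClopen {P : Type*} {t : TopologicalSpace P}
    (hP : IsPolishZeroDim P t) {U : Set P} (hU : IsOpen U) :
    ∃ C : ℕ → Set P, (∀ n, IsClopen (C n)) ∧ U = ⋃ n, C n := by
  have := hP.1
  obtain ⟨S, hS, rfl⟩ := IsTopologicalBasis.open_eq_sUnion hP.2 hU
  obtain ⟨T, hTc, hTS, hT⟩ := isOpen_sUnion_countable S fun s hs => (hS hs).2
  rcases T.eq_empty_or_nonempty with rfl | hne
  · exact ⟨fun _ => ∅, fun _ => isClopen_empty, by simp [← hT]⟩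
  · obtain ⟨C, hC⟩ := hTc.exists_eq_range hne
    refine ⟨C, fun n => hS (hTS (hC ▸ mem_range_self n)), ?_⟩
    rw [← hT, hC, sUnion_range]

end Polish

/-! ### Differences of open sets and alternation -/

section Differences

variable {P : Type w} [t : TopologicalSpace P]

/-- A set is a difference of `n` open sets iff membership is decided by the parity of an upper
semicontinuous rank function with values at most `n`. -/
lemma diffOpen_iff_rank {n : ℕ} {A : Set P} : DiffOpen n P t A ↔
    ∃ r : P → ℕ, (∀ i, IsOpen {x | r x ≤ i}) ∧ (∀ x, r x ≤ n) ∧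
      ∀ x, x ∈ A ↔ r x % 2 ≠ n % 2 := by
  classical
  constructor
  · rintro ⟨U, hU, hUo, rfl⟩
    have hex : ∀ x, ∃ i, i = n ∨ ∃ h : i < n, x ∈ U ⟨i, h⟩ := fun x => ⟨n, .inl rfl⟩
    have hle : ∀ x, Nat.find (hex x) ≤ n := fun x => Nat.find_min' _ (.inl rfl)
    -- The rank is the least index of an open set containing the point, and `n` if there is none;
    -- the value `n` has the parity of non-members.
    refine ⟨fun x => Nat.find (hex x), fun i => ?_, hle, fun x => ?_⟩
    · by_cases hi : i < n
      · convert! hUo ⟨i, hi⟩ using 1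
        ext x
        simp only [mem_ofPred_eq, Nat.find_le_iff]
        constructor
        · rintro ⟨m, hm, rfl | ⟨h, hx⟩⟩
          · omega
          · exact hU (show (⟨m, h⟩ : Fin n) ≤ ⟨i, hi⟩ from hm) hx
        · exact fun hx => ⟨i, le_rfl, .inr ⟨hi, hx⟩⟩
      · convert! isOpen_univ using 1
        exact eq_univ_of_forall fun x => (hle x).trans (not_lt.1 hi)
    · have hs := Nat.find_spec (hex x)
      have hm := fun m => @Nat.find_min _ _ (hex x) m
      dsimp only
      generalize Nat.find (hex x) = r at hs hm ⊢
      constructor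
      · rintro ⟨i, hi, hxi, hlt⟩
        have : r = i := by
          rcases lt_trichotomy r i with h | h | h
          · rcases hs with rfl | ⟨h', hx⟩
            · have := i.2
              omega
            · exact absurd hx (hlt ⟨r, h'⟩ h)
          · exact h
          · exact absurd (.inr ⟨i.2, hxi⟩) (hm _ h)
        rwa [this]
      · intro hr
        rcases hs with rfl | ⟨h, hx⟩
        · exact absurd rfl hr
        · exact ⟨⟨r, h⟩, hr, hx, fun j hj hxj => hm j hj (.inr ⟨j.2, hxj⟩)⟩
  · rintro ⟨r, hr, hrn, hA⟩
    refine ⟨fun i => {x | r x ≤ i}, fun i j hij x (hx : r x ≤ i) =>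
      show r x ≤ j from hx.trans hij, fun i => hr i, ?_⟩
    ext x
    rw [hA]
    constructor
    · intro h
      have hlt : r x < n := lt_of_le_of_ne (hrn x) (by rintro h'; exact h (by rw [h']))
      exact ⟨⟨r x, hlt⟩, h, show r x ≤ r x from le_rfl,
        fun j (hj : (j : ℕ) < r x) => show ¬ r x ≤ j from not_le.2 hj⟩
    · rintro ⟨i, hi, hxi, hlt⟩
      have : r x = i := by
        by_contra hne
        have hlt' : r x < i := lt_of_le_of_ne hxi hne
        exact hlt ⟨r x, hlt'.trans i.2⟩ hlt' (show r x ≤ r x from le_rfl)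
      rwa [this]

lemma DiffOpen.preimage {Q : Type*} [s : TopologicalSpace Q] {n : ℕ} {A : Set P}
    (hA : DiffOpen n P t A) {f : Q → P} (hf : Continuous f) : DiffOpen n Q s (f ⁻¹' A) := by
  obtain ⟨r, hr, hrn, h⟩ := diffOpen_iff_rank.1 hA
  exact diffOpen_iff_rank.2 ⟨r ∘ f, fun i => (hr i).preimage hf, fun x => hrn _, fun x => h _⟩

lemma diffOpen_zero {A : Set P} : DiffOpen 0 P t A ↔ A = ∅ := by
  constructor
  · rintro ⟨U, -, -, rfl⟩
    ext x
    simp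
  · rintro rfl
    exact ⟨fun i => i.elim0, fun i => i.elim0, fun i => i.elim0, by ext x; simp⟩

lemma diffOpen_succ {n : ℕ} {A : Set P} : DiffOpen (n + 1) P t A ↔
    ∃ V B : Set P, IsOpen V ∧ DiffOpen n P t B ∧ A = V \ B := by
  classical
  constructor
  · intro hA
    obtain ⟨r, hr, hrn, h⟩ := diffOpen_iff_rank.1 hA
    refine ⟨{x | r x ≤ n}, {x | min (r x) n % 2 ≠ n % 2}, hr n,
      diffOpen_iff_rank.2 ⟨fun x => min (r x) n, fun i => ?_, fun x => min_le_right _ _,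
        fun x => Iff.rfl⟩, ?_⟩
    · simp only [min_le_iff]
      exact (hr i).union isOpen_const
    · ext x
      have := hrn x
      simp only [h, mem_sdiff, mem_ofPred_eq]
      rcases le_total (r x) n with h' | h'
      · rw [min_eq_left h']
        omega
      · rw [min_eq_right h']
        omega
  · rintro ⟨V, B, hV, hB, rfl⟩
    obtain ⟨r, hr, hrn, h⟩ := diffOpen_iff_rank.1 hB
    refine diffOpen_iff_rank.2 ⟨fun x => if x ∈ V then r x else n + 1, fun i => ?_, fun x => ?_,
      fun x => ?_⟩
    · by_cases hi : n + 1 ≤ i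
      · convert! isOpen_univ using 1
        refine eq_univ_of_forall fun x => ?_
        have := hrn x
        simp only [mem_ofPred_eq]
        split_ifs <;> omega
      · convert! hV.inter (hr i) using 1
        ext x
        by_cases hx : x ∈ V <;> simp [hx] ; omega
    · have := hrn x
      dsimp only
      split_ifs <;> omega
    · have := h x
      by_cases hx : x ∈ V <;> simp [hx, this]
      omega

/-- The iterated alternation derivative of a set: it is empty after `n` steps iff the set is a
difference of `n` open sets. -/
def alternation : ℕ → Set P → Set P
  | 0, A => A
  | n + 1, A => A ∩ closure (alternation n Aᶜ)

lemma alternation_subset (n : ℕ) (A : Set P) : alternation n A ⊆ A := by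
  cases n with
  | zero => exact subset_rfl
  | succ n => exact inter_subset_left

/-- The derivative is local, because closure is local on open sets. -/
lemma alternation_inter_congr {V : Set P} (hV : IsOpen V) (n : ℕ) :
    ∀ {A B : Set P}, A ∩ V = B ∩ V → alternation n A ∩ V ⊆ alternation n B := by
  induction n with
  | zero => exact fun h x hx => (h ▸ hx : x ∈ _ ∩ V).1
  | succ n ih =>
    intro A B h x ⟨⟨hxA, hxc⟩, hxV⟩
    refine ⟨(h ▸ ⟨hxA, hxV⟩ : x ∈ B ∩ V).1, ?_⟩
    have hc : Aᶜ ∩ V = Bᶜ ∩ V := by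
      ext y
      have := Set.ext_iff.1 h y
      simp only [mem_inter_iff, mem_compl_iff] at this ⊢
      tauto
    refine closure_mono (ih hc) ?_
    rw [inter_comm]
    exact hV.inter_closure ⟨hxV, hxc⟩

lemma diffOpen_iff_alternation (n : ℕ) :
    ∀ {A : Set P}, DiffOpen n P t A ↔ alternation n A = ∅ := by
  induction n with
  | zero => exact diffOpen_zero
  | succ n ih =>
    intro A
    rw [diffOpen_succ]
    constructor
    · rintro ⟨V, B, hV, hB, rfl⟩
      rw [eq_empty_iff_forall_notMem]
      rintro x ⟨⟨hxV, -⟩, hxc⟩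
      obtain ⟨y, hyV, hy⟩ := mem_closure_iff.1 hxc V hV hxV
      have : alternation n (V \ B)ᶜ ∩ V ⊆ alternation n B := by
        refine alternation_inter_congr hV n ?_
        ext z
        simp only [mem_inter_iff, mem_compl_iff, mem_sdiff]
        tauto
      rw [ih.1 hB] at this
      exact this ⟨hy, hyV⟩
    · intro h
      have hAV : A ⊆ (closure (alternation n Aᶜ))ᶜ := fun x hxA hxc =>
        (h ▸ (⟨hxA, hxc⟩ : x ∈ alternation (n + 1) A) : x ∈ (∅ : Set P))
      -- This is the largest open set disjoint from `alternation n Aᶜ`. By locality a surviving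
      -- point of `V \ A` would lie in that derivative, so `V \ A` is a difference of `n` open sets.
      have hV : IsOpen (closure (alternation n Aᶜ))ᶜ := isClosed_closure.isOpen_compl
      refine ⟨_, (closure (alternation n Aᶜ))ᶜ \ A, hV, ?_, ?_⟩
      · rw [ih, eq_empty_iff_forall_notMem]
        intro x hx
        have hxV := (alternation_subset n _ hx).1
        refine hxV (subset_closure (alternation_inter_congr hV n ?_ ⟨hx, hxV⟩))
        ext z
        simp only [mem_inter_iff, mem_compl_iff, mem_sdiff]
        tauto
      · rw [sdiff_sdiff_right_self, inter_eq_self_of_subset_right hAV]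

/-- Glueing a sequence of maps that shrink to a point along a union of clopen sets. -/
lemma exists_continuous_glue {Q : Type*} [TopologicalSpace Q] {C : ℕ → Set Q}
    (hC : ∀ n, IsClopen (C n)) {x : P} {N : ℕ → Set P} (hN : (𝓝 x).HasAntitoneBasis N)
    {f : ℕ → Q → P} (hf : ∀ n, Continuous (f n)) (hfN : ∀ n q, f n q ∈ N n) :
    ∃ g : Q → P, Continuous g ∧ (∀ q ∈ ⋃ n, C n, ∃ n, g q = f n q) ∧
      ∀ q ∉ ⋃ n, C n, g q = x := by
  classical
  let g : Q → P := fun q => if h : ∃ n, q ∈ C n then f (Nat.find h) q else x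
  have hpos : ∀ q (h : ∃ n, q ∈ C n), g q = f (Nat.find h) q := fun q h => dif_pos h
  have hneg : ∀ q, (¬ ∃ n, q ∈ C n) → g q = x := fun q h => dif_neg h
  refine ⟨g, continuous_iff_continuousAt.2 fun q => ?_,
    fun q hq => ⟨_, hpos q (mem_iUnion.1 hq)⟩, fun q hq => hneg q (mt mem_iUnion.2 hq)⟩
  by_cases h : ∃ n, q ∈ C n
  · have hO : IsOpen (C (Nat.find h) ∩ ⋂ m ∈ Iio (Nat.find h), (C m)ᶜ) :=
      (hC _).isOpen.inter ((finite_Iio _).isOpen_biInter fun m _ => (hC m).compl.isOpen)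
    refine (hf (Nat.find h)).continuousAt.congr (Filter.eventuallyEq_iff_exists_mem.2
      ⟨_, hO.mem_nhds ⟨Nat.find_spec h, ?_⟩, ?_⟩)
    · simp only [mem_iInter]
      exact fun m hm => Nat.find_min h hm
    · rintro q' ⟨h1, h2⟩
      simp only [mem_iInter] at h2
      have h' : ∃ n, q' ∈ C n := ⟨_, h1⟩
      have : Nat.find h' = Nat.find h := (Nat.find_eq_iff h').2 ⟨h1, fun m hm => h2 m hm⟩
      rw [hpos q' h', this]
  -- Off the union, some neighbourhood misses the first `i` clopen sets, so only maps with values in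
  -- `N i`, or the value `x`, occur there.
  · rw [ContinuousAt, hneg q h, hN.1.tendsto_right_iff]
    rintro i -
    have hO : IsOpen (⋂ m ∈ Iio i, (C m)ᶜ) :=
      (finite_Iio _).isOpen_biInter fun m _ => (hC m).compl.isOpen
    filter_upwards [hO.mem_nhds (mem_iInter₂.2 fun m _ hm => h ⟨m, hm⟩)] with q' hq'
    simp only [mem_iInter] at hq'
    by_cases h' : ∃ n, q' ∈ C n
    · rw [hpos q' h']
      exact hN.2 (not_lt.1 fun hlt => hq' _ hlt (Nat.find_spec h')) (hfN _ _)
    · rw [hneg q' h']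
      exact mem_of_mem_nhds (hN.1.mem_of_mem trivial)

/-- A Wadge-type reduction: if `A` has a point of alternation rank `n`, then the complement of
every difference of `n` open sets is a continuous preimage of `A`. -/
lemma exists_continuous_preimage_eq [FirstCountableTopology P] {Q : Type*}
    {s : TopologicalSpace Q} (hQ : IsPolishZeroDim Q s) (n : ℕ) :
    ∀ {A N : Set P} {x : P} {B : Set Q}, x ∈ alternation n A → N ∈ 𝓝 x → DiffOpen n Q s Bᶜ →
      ∃ f : Q → P, Continuous f ∧ (∀ q, f q ∈ N) ∧ B = f ⁻¹' A := by
  induction n with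
  | zero =>
    intro A N x B hx hN hB
    refine ⟨fun _ => x, continuous_const, fun _ => mem_of_mem_nhds hN, ?_⟩
    rw [diffOpen_zero, compl_empty_iff] at hB
    subst hB
    exact (eq_univ_of_forall fun _ => hx).symm
  | succ n ih =>
    intro A N x B hx hN hB
    obtain ⟨V, D, hV, hD, hBV⟩ := diffOpen_succ.1 hB
    obtain ⟨C, hC, rfl⟩ := hQ.exists_iUnion_isClopen hV
    obtain ⟨M, hM⟩ := (𝓝 x).exists_antitone_basis
    have hMN : (𝓝 x).HasAntitoneBasis fun i => M i ∩ N :=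
      ⟨hM.1.to_hasBasis' (fun i _ => ⟨i, trivial, inter_subset_left⟩)
        fun i _ => Filter.inter_mem (hM.mem i) hN, fun i j h => inter_subset_inter_left _ (hM.2 h)⟩
    -- Arbitrarily close to `x` lie points of `alternation n Aᶜ`, so the induction hypothesis
    -- reduces `Dᶜ` to `Aᶜ` there. Points outside `V` belong to `B` and are sent to `x ∈ A`.
    have key : ∀ i, ∃ f : Q → P, Continuous f ∧ (∀ q, f q ∈ M i ∩ N) ∧ Dᶜ = f ⁻¹' Aᶜ := by
      intro i
      obtain ⟨y, hyM, hy⟩ := mem_closure_iff_nhds.1 hx.2 _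
        (interior_mem_nhds.2 (hMN.1.mem_of_mem (i := i) trivial))
      obtain ⟨f, hf, hfM, h⟩ := ih hy (isOpen_interior.mem_nhds hyM) (by rwa [compl_compl])
      exact ⟨f, hf, fun q => interior_subset (hfM q), h⟩
    choose f hf hfM hfD using key
    obtain ⟨g, hg, hg1, hg2⟩ := exists_continuous_glue hC hMN hf hfM
    refine ⟨g, hg, fun q => ?_, ?_⟩
    · by_cases hq : q ∈ ⋃ n, C n
      · obtain ⟨i, hi⟩ := hg1 q hq
        exact hi ▸ (hfM i q).2
      · exact hg2 q hq ▸ mem_of_mem_nhds hN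
    · ext q
      have hq' := Set.ext_iff.1 hBV q
      simp only [mem_compl_iff, mem_sdiff] at hq'
      by_cases hq : q ∈ ⋃ n, C n
      · obtain ⟨i, hi⟩ := hg1 q hq
        have := Set.ext_iff.1 (hfD i) q
        simp only [mem_compl_iff, mem_preimage] at this
        rw [mem_preimage, hi]
        tauto
      · rw [mem_preimage, hg2 q hq]
        have := hx.1
        tauto

end Differences

/-! ### Absorbing a clopen innermost layer -/

section Shift

variable {P : Type w} [t : TopologicalSpace P]

/-- If the innermost open set of a difference is clopen, it can be absorbed in the third layer. -/
lemma diffOpen_of_isClopen_rank_zero {n : ℕ} (hn : 1 ≤ n) {A : Set P} {r : P → ℕ}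
    (hr : ∀ i, IsOpen {x | r x ≤ i}) (hrn : ∀ x, r x ≤ n + 1)
    (hA : ∀ x, x ∈ A ↔ r x % 2 ≠ (n + 1) % 2) (h0 : IsClosed {x | r x ≤ 0}) :
    DiffOpen n P t A := by
  -- Every rank changes parity, as does the bound. Closedness of `{r ≤ 0}` is what makes the new
  -- rank-zero set `{r = 1}` open; `1 ≤ n` leaves room for the value `1`.
  refine diffOpen_iff_rank.2 ⟨fun x => if r x = 0 then 1 else r x - 1, fun i => ?_, fun x => ?_,
    fun x => ?_⟩
  · rcases Nat.eq_zero_or_pos i with rfl | hi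
    · convert! (hr 1).sdiff h0 using 1
      ext x
      simp only [mem_ofPred_eq, mem_sdiff]
      split_ifs <;> omega
    · convert! hr (i + 1) using 1
      ext x
      simp only [mem_ofPred_eq]
      split_ifs <;> omega
  · have := hrn x
    dsimp only
    split_ifs <;> omega
  · rw [hA]
    dsimp only
    split_ifs <;> omega

end Shift

/-! ### The successor class -/

section Successor

/-- The class of the sets that coincide with a difference of `n` open sets on a clopen set and with
the complement of one outside of it. -/
def DiffOpenJoin (n : ℕ) : PointClass.{w} :=
  fun P t A => ∃ C A₁ A₂ : Set P, IsClopen C ∧ DiffOpen n P t A₁ ∧ DiffOpen n P t A₂ ∧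
    ∀ x, x ∈ A ↔ (x ∈ C ∧ x ∈ A₁) ∨ (x ∉ C ∧ x ∉ A₂)

lemma diffOpen_empty (n : ℕ) (P : Type w) (t : TopologicalSpace P) : DiffOpen n P t ∅ :=
  diffOpen_iff_rank.2 ⟨fun _ => n, fun _ => isOpen_const, fun _ => le_rfl, by simp⟩

lemma diffOpen_incl_join (n : ℕ) : (DiffOpen.{w} n).Incl (DiffOpenJoin n) :=
  fun P t _ A hA => ⟨univ, A, ∅, isClopen_univ, hA, diffOpen_empty n P t, by simp⟩

lemma diffOpen_dual_incl_join (n : ℕ) : (DiffOpen.{w} n).dual.Incl (DiffOpenJoin n) :=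
  fun P t _ A hA => ⟨∅, ∅, Aᶜ, isClopen_empty, diffOpen_empty n P t, hA, by simp⟩

lemma DiffOpenJoin.compl {n : ℕ} {P : Type w} {t : TopologicalSpace P} {A : Set P}
    (h : DiffOpenJoin n P t A) : DiffOpenJoin n P t Aᶜ := by
  obtain ⟨C, A₁, A₂, hC, h₁, h₂, h⟩ := h
  refine ⟨Cᶜ, A₂, A₁, hC.compl, h₂, h₁, fun x => ?_⟩
  have := h x
  simp only [mem_compl_iff]
  tauto

lemma DiffOpenJoin.diffOpen_succ {n : ℕ} {P : Type w} {t : TopologicalSpace P} {A : Set P}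
    (h : DiffOpenJoin n P t A) : DiffOpen (n + 1) P t A := by
  classical
  obtain ⟨C, A₁, A₂, hC, h₁, h₂, h⟩ := h
  obtain ⟨r₁, hr₁, hn₁, h₁⟩ := diffOpen_iff_rank.1 h₁
  obtain ⟨r₂, hr₂, hn₂, h₂⟩ := diffOpen_iff_rank.1 h₂
  -- Passing from `n` to `n + 1` flips the parity: raising the rank by one preserves membership,
  -- keeping it complements.
  refine diffOpen_iff_rank.2 ⟨fun x => if x ∈ C then r₁ x + 1 else r₂ x, fun i => ?_, fun x => ?_,
    fun x => ?_⟩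
  · have h1 : IsOpen {x | r₁ x + 1 ≤ i} := by
      rcases i with _ | i
      · simp
      · simpa using hr₁ i
    convert! (hC.isOpen.inter h1).union (hC.compl.isOpen.inter (hr₂ i)) using 1
    ext x
    by_cases hx : x ∈ C <;> simp [hx]
  · have := hn₁ x
    have := hn₂ x
    dsimp only
    split_ifs <;> omega
  · rw [h, h₁, h₂]
    by_cases hx : x ∈ C <;> simp only [hx, if_true, if_false] <;> simp <;> omega

/-- A complete difference of `n` open sets. -/
def completeDiff (n : ℕ) : Set (Fin n → ℕ → Bool) :=
  {x | ∃ i : Fin n, (i : ℕ) % 2 ≠ n % 2 ∧ x i ≠ (fun _ => false) ∧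
    ∀ j < i, x j = fun _ => false}

lemma diffOpen_completeDiff (n : ℕ) : DiffOpen n _ inferInstance (completeDiff n) := by
  refine ⟨fun i => ⋃ j ∈ Iic i, {x | x j ≠ fun _ => false},
    fun i j hij => biUnion_subset_biUnion_left (Iic_subset_Iic.2 hij), fun i => ?_, ?_⟩
  · exact isOpen_biUnion fun j _ => isOpen_ne.preimage (continuous_apply j)
  · ext x
    simp only [completeDiff, mem_ofPred_eq, mem_iUnion, mem_Iic, not_exists, not_not, exists_prop,
      not_and]
    refine exists_congr fun i => and_congr_right fun _ => ⟨fun ⟨h1, h2⟩ =>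
      ⟨⟨i, le_rfl, h1⟩, fun j hj l hl => h2 l (hl.trans_lt hj)⟩,
      fun ⟨⟨l, hl, h1⟩, h2⟩ => ?_⟩
    have h3 : ∀ j < i, x j = fun _ => false := fun j hj => h2 j hj j le_rfl
    rcases hl.lt_or_eq with hl | rfl
    · exact absurd (h3 l hl) h1
    · exact ⟨h1, h3⟩

/-- Being a nonzero binary sequence is a complete open condition: record which clopen pieces of each
open set contain the point. -/
lemma exists_preimage_completeDiff {n : ℕ} {P : Type w} {t : TopologicalSpace P}
    (hP : IsPolishZeroDim P t) {A : Set P} (hA : DiffOpen n P t A) :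
    ∃ f : P → Fin n → ℕ → Bool, Continuous f ∧ A = f ⁻¹' completeDiff n := by
  classical
  obtain ⟨U, -, hU, rfl⟩ := hA
  choose C hC hCU using fun i => hP.exists_iUnion_isClopen (hU i)
  refine ⟨fun x i m => decide (x ∈ C i m), ?_, ?_⟩
  · refine continuous_pi fun i => continuous_pi fun m => ?_
    refine continuous_def.2 fun s _ => ?_
    exact (IsClopen.isOpen (by
      have : (fun x => decide (x ∈ C i m)) ⁻¹' s =
          ({x | x ∈ C i m ∧ true ∈ s} ∪ {x | x ∉ C i m ∧ false ∈ s}) := by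
        ext x
        by_cases hx : x ∈ C i m <;> simp [hx]
      rw [this]
      exact ((hC i m).inter ⟨isClosed_const, isOpen_const⟩).union
        ((hC i m).compl.inter ⟨isClosed_const, isOpen_const⟩)))
  · have key : ∀ x i, x ∈ U i ↔ (fun m => decide (x ∈ C i m)) ≠ fun _ => false := by
      intro x i
      rw [hCU, Ne, funext_iff]
      simp
    ext x
    simp only [completeDiff, mem_ofPred_eq, mem_preimage, key, not_not]

/-- A point with exactly `i` leading zero coordinates is a limit of points with `i - 1` of them,
which lie on the other side of the set; so it survives `i` derivatives. -/
lemma mem_alternation_completeDiff {n : ℕ} (i : ℕ) :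
    ∀ {x : Fin n → ℕ → Bool} {A : Set (Fin n → ℕ → Bool)}, i ≤ n →
      (∀ j : Fin n, (j : ℕ) < i → x j = fun _ => false) →
      (∀ j : Fin n, (j : ℕ) = i → x j ≠ fun _ => false) →
      A = (if i % 2 ≠ n % 2 then completeDiff n else (completeDiff n)ᶜ) →
      x ∈ alternation i A := by
  have base : ∀ (i : ℕ) (x : Fin n → ℕ → Bool) (A : Set (Fin n → ℕ → Bool)), i ≤ n →
      (∀ j : Fin n, (j : ℕ) < i → x j = fun _ => false) →
      (∀ j : Fin n, (j : ℕ) = i → x j ≠ fun _ => false) →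
      A = (if i % 2 ≠ n % 2 then completeDiff n else (completeDiff n)ᶜ) → x ∈ A := by
    rintro i x A hi hx hxi rfl
    split_ifs with h
    · have hlt : i < n := lt_of_le_of_ne hi (by rintro rfl; exact h rfl)
      exact ⟨⟨i, hlt⟩, h, hxi _ rfl, fun j hj => hx j hj⟩
    · rintro ⟨l, hl, hxl, hlt⟩
      rcases lt_trichotomy (l : ℕ) i with h' | h' | h'
      · exact hxl (hx l h')
      · rw [h'] at hl
        exact h hl
      · have hin : i < n := h'.trans l.2
        exact hxi ⟨i, hin⟩ rfl (hlt ⟨i, hin⟩ h')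
  induction i with
  | zero => exact fun hi h1 h2 h3 => base 0 _ _ hi h1 h2 h3
  | succ i ih =>
    intro x A hi h1 h2 h3
    refine ⟨base _ x A hi h1 h2 h3, ?_⟩
    have hin : i < n := hi
    -- The last leading zero coordinate is replaced by the indicator of `{m}`, which is nonzero and
    -- tends to zero.
    let y : ℕ → Fin n → ℕ → Bool := fun m => Function.update x ⟨i, hin⟩ fun l => decide (l = m)
    have hy : Filter.Tendsto y Filter.atTop (𝓝 x) := by
      rw [tendsto_pi_nhds]
      intro j
      rw [tendsto_pi_nhds]
      intro l
      refine tendsto_const_nhds.congr' ?_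
      filter_upwards [Filter.eventually_gt_atTop l] with m hm
      by_cases hj : j = ⟨i, hin⟩
      · subst hj
        simp [y, h1 ⟨i, hin⟩ (Nat.lt_succ_self i), hm.ne]
      · simp [y, hj]
    refine mem_closure_of_tendsto hy (Filter.Eventually.of_forall fun m => ?_)
    refine ih hin.le (fun j hj => ?_) (fun j hj => ?_) ?_
    · have : j ≠ ⟨i, hin⟩ := fun h => by simp [h] at hj
      simp only [y, Function.update_of_ne this]
      exact h1 j (hj.trans (Nat.lt_succ_self i))
    · have : j = ⟨i, hin⟩ := Fin.ext hj
      subst this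
      intro h
      have := congrFun h m
      simp [y] at this
    · rw [h3]
      by_cases h : i % 2 = n % 2
      · have h' : (i + 1) % 2 ≠ n % 2 := by omega
        simp [h, h']
      · have h' : (i + 1) % 2 = n % 2 := by omega
        simp [h, h']

lemma not_diffOpen_compl_completeDiff (n : ℕ) :
    ¬ DiffOpen n _ inferInstance (completeDiff n)ᶜ := by
  rw [diffOpen_iff_alternation]
  refine (Set.nonempty_of_mem (mem_alternation_completeDiff n (x := fun _ _ => false) le_rfl
    (fun _ _ => rfl) (fun j hj => absurd hj j.2.ne) ?_)).ne_empty
  simp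

lemma diffOpen_strictIncl_join (n : ℕ) : (DiffOpen.{w} n).StrictIncl (DiffOpenJoin n) := by
  refine ⟨diffOpen_incl_join n, fun h => not_diffOpen_compl_completeDiff n ?_⟩
  have h1 : DiffOpen n (ULift.{w} (Fin n → ℕ → Bool)) inferInstance
      (ULift.down ⁻¹' (completeDiff n)ᶜ) := by
    refine h _ _ (isPolishZeroDim_uLift _) _ (diffOpen_dual_incl_join n _ _
      (isPolishZeroDim_uLift _) _ ?_)
    change DiffOpen n _ _ (ULift.down ⁻¹' (completeDiff n)ᶜ)ᶜ
    rw [← preimage_compl, compl_compl]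
    exact (diffOpen_completeDiff n).preimage continuous_uliftDown
  exact h1.preimage continuous_uliftUp

lemma DiffOpen.measurableSet {n : ℕ} {P : Type w} [t : TopologicalSpace P] {A : Set P}
    (hA : DiffOpen n P t A) : @MeasurableSet P (borel P) A := by
  borelize P
  induction n generalizing A with
  | zero => rw [diffOpen_zero.1 hA]; exact MeasurableSet.empty
  | succ n ih =>
    obtain ⟨V, B, hV, hB, rfl⟩ := diffOpen_succ.1 hA
    exact hV.measurableSet.diff (ih hB)

lemma DiffOpenJoin.measurableSet {n : ℕ} {P : Type w} [t : TopologicalSpace P] {A : Set P}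
    (hA : DiffOpenJoin n P t A) : @MeasurableSet P (borel P) A :=
  hA.diffOpen_succ.measurableSet

lemma DiffOpenJoin.preimage {n : ℕ} {P : Type w} {Q : Type v} {t : TopologicalSpace P}
    {s : TopologicalSpace Q} {A : Set P} (hA : DiffOpenJoin n P t A) {f : Q → P}
    (hf : Continuous f) : DiffOpenJoin n Q s (f ⁻¹' A) := by
  obtain ⟨C, A₁, A₂, hC, h₁, h₂, h⟩ := hA
  exact ⟨f ⁻¹' C, f ⁻¹' A₁, f ⁻¹' A₂, hC.preimage hf, h₁.preimage hf, h₂.preimage hf,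
    fun x => h (f x)⟩

/-- A complete set for the class `DiffOpenJoin n`. -/
def completeJoin (n : ℕ) : Set (Bool × (Fin n → ℕ → Bool)) :=
  {z | (z.1 = true ∧ z.2 ∈ completeDiff n) ∨ (z.1 = false ∧ z.2 ∉ completeDiff n)}

lemma diffOpenJoin_completeJoin (n : ℕ) : DiffOpenJoin n _ inferInstance (completeJoin n) := by
  refine ⟨Prod.fst ⁻¹' {true}, Prod.snd ⁻¹' completeDiff n, Prod.snd ⁻¹' completeDiff n,
    (isClopen_discrete _).preimage continuous_fst,
    (diffOpen_completeDiff n).preimage continuous_snd,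
    (diffOpen_completeDiff n).preimage continuous_snd, ?_⟩
  rintro ⟨b, z⟩
  simp [completeJoin]

lemma continuous_ite_isClopen {P Q : Type*} [TopologicalSpace P] [TopologicalSpace Q] {C : Set P}
    [∀ x, Decidable (x ∈ C)] (hC : IsClopen C) {f g : P → Q} (hf : Continuous f)
    (hg : Continuous g) : Continuous fun x => if x ∈ C then f x else g x :=
  hf.if (fun a ha => by
    have : a ∈ frontier C := ha
    simp [hC.frontier_eq] at this) hg

lemma isWadgeClass_join (n : ℕ) : IsWadgeClass.{w} (DiffOpenJoin n) := by
  classical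
  have hS : DiffOpenJoin n (ULift.{w} (Bool × (Fin n → ℕ → Bool))) inferInstance
      (ULift.down ⁻¹' completeJoin n) :=
    (diffOpenJoin_completeJoin n).preimage continuous_uliftDown
  refine ⟨_, inferInstance, _, isPolishZeroDim_uLift _, hS.measurableSet,
    fun P t hP A => ⟨?_, ?_⟩⟩
  · rintro ⟨C, A₁, A₂, hC, h₁, h₂, h⟩
    obtain ⟨f₁, hf₁, rfl⟩ := exists_preimage_completeDiff hP h₁
    obtain ⟨f₂, hf₂, rfl⟩ := exists_preimage_completeDiff hP h₂
    refine ⟨fun x => if x ∈ C then ⟨true, f₁ x⟩ else ⟨false, f₂ x⟩, continuous_ite_isClopen hC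
      (continuous_uliftUp.comp (continuous_const.prodMk hf₁))
      (continuous_uliftUp.comp (continuous_const.prodMk hf₂)), ?_⟩
    ext x
    rw [h]
    by_cases hx : x ∈ C <;> simp [hx, completeJoin]
  · rintro ⟨f, hf, rfl⟩
    exact hS.preimage hf

/-- The generator `A₀` of `Γ` is not in `D_n`, otherwise `Γ` would be included in `D_n`. Both halves
of a join then reduce to `A₀`, and the two reductions glue along the clopen set. -/
lemma join_incl_of_strictIncl {n : ℕ} {Γ : PointClass.{w}} (hΓ : IsWadgeClass Γ)
    (h : (DiffOpen n).StrictIncl Γ) : (DiffOpenJoin n).Incl Γ := by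
  classical
  obtain ⟨P₀, t₀, A₀, hP₀, -, hA₀⟩ := hΓ
  have hnot : ¬ DiffOpen n P₀ t₀ A₀ := by
    refine fun hD => h.2 fun P t hP A hA => ?_
    obtain ⟨f, hf, rfl⟩ := (hA₀ P t hP A).1 hA
    exact hD.preimage hf
  rw [diffOpen_iff_alternation, ← Ne, ← nonempty_iff_ne_empty] at hnot
  obtain ⟨x, hx⟩ := hnot
  rintro P t hP A ⟨C, A₁, A₂, hC, h₁, h₂, hA⟩
  obtain ⟨f₁, hf₁, rfl⟩ := (hA₀ P t hP A₁).1 (h.1 P t hP A₁ h₁)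
  have := hP₀.1
  obtain ⟨f₂, hf₂, -, h₂⟩ := exists_continuous_preimage_eq hP n (B := A₂ᶜ) hx Filter.univ_mem
    (by rwa [compl_compl])
  refine (hA₀ P t hP A).2
    ⟨fun x => if x ∈ C then f₁ x else f₂ x, continuous_ite_isClopen hC hf₁ hf₂, ?_⟩
  ext y
  have h₂' := Set.ext_iff.1 h₂ y
  simp only [mem_compl_iff, mem_preimage] at h₂'
  rw [hA, h₂']
  by_cases hy : y ∈ C <;> simp [hy]

lemma diffOpen_succ_iff_join (n : ℕ) {P : Type w} {t : TopologicalSpace P}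
    (hP : IsPolishZeroDim P t) (A : Set P) : (DiffOpen n).succ P t A ↔ DiffOpenJoin n P t A :=
  ⟨fun h => h _ (isWadgeClass_join n) (diffOpen_strictIncl_join n),
    fun h _ hΓ hs => join_incl_of_strictIncl hΓ hs P t hP A h⟩

/-- The successor class of the differences of `n` open sets exists. -/
lemma isWadgeSucc_diffOpen (n : ℕ) : IsWadgeSucc.{w} (DiffOpen n) (DiffOpen n).succ := by
  have hs := diffOpen_strictIncl_join.{w} n
  refine ⟨?_, ⟨fun P t hP A hA => ?_, fun h => hs.2 fun P t hP A hA => ?_⟩,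
    fun Γ hΓ h P t hP A hA => hA Γ hΓ h⟩
  · obtain ⟨P₀, t₀, A₀, hP₀, hm, hA₀⟩ := isWadgeClass_join.{w} n
    exact ⟨P₀, t₀, A₀, hP₀, hm, fun P t hP A =>
      (diffOpen_succ_iff_join n hP A).trans (hA₀ P t hP A)⟩
  · exact (diffOpen_succ_iff_join n hP A).2 (hs.1 P t hP A hA)
  · exact h P t hP A ((diffOpen_succ_iff_join n hP A).2 hA)

end Successor

/-! ### Potential classes and countable sections -/

section Potential

variable {X : Type u} {Y : Type v}

lemma Pot.mono [TopologicalSpace X] [TopologicalSpace Y] {Γ Γ' : PointClass.{max u v}}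
    {A : Set (X × Y)} (h : Γ.Incl Γ') (hA : Pot Γ A) : Pot Γ' A := by
  obtain ⟨σ, τ, hσ, hτ, hX, hY, hA⟩ := hA
  exact ⟨σ, τ, hσ, hτ, hX, hY, h _ _ (hX.prod hY) A hA⟩

lemma countable_snd_image_of_isOpen [TopologicalSpace X] [TopologicalSpace Y]
    [SecondCountableTopology Y] {U : Set (X × Y)} (hU : IsOpen U)
    (hsec : ∀ x : X, {y : Y | (x, y) ∈ U}.Countable) : (Prod.snd '' U).Countable := by
  have h : Prod.snd '' U ⊆
      ⋃ V ∈ {V ∈ countableBasis Y | V.Countable}, V := by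
    rintro _ ⟨⟨x, y⟩, hxy, rfl⟩
    have hy : IsOpen {y : Y | (x, y) ∈ U} := hU.preimage (Continuous.prodMk_right x)
    obtain ⟨V, hV, hyV, hVU⟩ := (isBasis_countableBasis Y).exists_subset_of_mem_open hxy hy
    exact mem_biUnion ⟨hV, (hsec x).mono hVU⟩ hyV
  refine Countable.mono h (Countable.biUnion ?_ fun V hV => hV.2)
  exact (countable_countableBasis Y).mono (sep_subset _ _)

/-- A Borel set with countable projection becomes clopen for finer topologies on the factors. -/
lemma exists_isClopen_prod_of_countable_snd_image [tX : TopologicalSpace X] [PolishSpace X]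
    [tY : TopologicalSpace Y] [PolishSpace Y] {U : Set (X × Y)}
    (hU : @MeasurableSet (X × Y) (borel (X × Y)) U) (hc : (Prod.snd '' U).Countable) :
    ∃ (σ : TopologicalSpace X) (τ : TopologicalSpace Y), σ ≤ tX ∧ τ ≤ tY ∧
      IsPolishZeroDim X σ ∧ IsPolishZeroDim Y τ ∧ IsClopen U := by
  obtain ⟨σ, hσ, hXσ, hcσ⟩ := exists_polishZeroDim_isClopen
    (hc.image fun y => {x : X | (x, y) ∈ U}) (by
      rintro _ ⟨y, -, rfl⟩
      borelize X (X × Y)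
      exact (Continuous.prodMk_left y).measurable hU)
  -- Clopen points of the projection make `U` open; the projection itself must also be clopen to
  -- handle `Uᶜ` away from it.
  obtain ⟨τ, hτ, hYτ, hcτ⟩ := exists_polishZeroDim_isClopen
    (S := insert (Prod.snd '' U) ((fun y => {y}) '' (Prod.snd '' U)))
    ((hc.image _).insert _) (by
      borelize Y
      rintro s (rfl | ⟨y, -, rfl⟩)
      · exact hc.measurableSet
      · exact measurableSet_singleton y)
  refine ⟨σ, τ, hσ, hτ, hXσ, hYτ, ?_⟩
  have hsec : ∀ y ∈ Prod.snd '' U, @IsClopen X σ {x : X | (x, y) ∈ U} :=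
    fun y hy => hcσ _ (mem_image_of_mem _ hy)
  have hpt : ∀ y ∈ Prod.snd '' U, @IsClopen Y τ {y} :=
    fun y hy => hcτ _ (mem_insert_of_mem _ (mem_image_of_mem _ hy))
  have hpr : @IsClopen Y τ (Prod.snd '' U) := hcτ _ (mem_insert _ _)
  constructor
  · have h : Uᶜ = (univ ×ˢ (Prod.snd '' U)ᶜ) ∪
        ⋃ y ∈ Prod.snd '' U, {x : X | (x, y) ∈ U}ᶜ ×ˢ {y} := by
      ext ⟨x, y⟩
      simp only [mem_compl_iff, mem_union, mem_prod, mem_univ, true_and, mem_iUnion,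
        exists_prop, mem_ofPred_eq, mem_singleton_iff]
      constructor
      · intro h
        by_cases hy : y ∈ Prod.snd '' U
        · exact .inr ⟨y, hy, h, rfl⟩
        · exact .inl hy
      · rintro (h | ⟨_, -, h, rfl⟩) hU
        · exact h ⟨_, hU, rfl⟩
        · exact h hU
    rw [← isOpen_compl_iff, h]
    exact (isOpen_univ.prod hpr.compl.isOpen).union
      (isOpen_biUnion fun y hy => (hsec y hy).compl.isOpen.prod (hpt y hy).isOpen)
  · have h : U = ⋃ y ∈ Prod.snd '' U, {x : X | (x, y) ∈ U} ×ˢ {y} := by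
      ext ⟨x, y⟩
      simpa using fun h => ⟨x, h⟩
    rw [h]
    exact isOpen_biUnion fun y hy => (hsec y hy).isOpen.prod (hpt y hy).isOpen

/-- A potential difference of `n + 1` open sets whose innermost open set has countable vertical
sections is potentially a difference of `n` open sets. -/
lemma pot_diffOpen_of_succ [TopologicalSpace X] [TopologicalSpace Y] {n : ℕ} (hn : 1 ≤ n)
    {A D : Set (X × Y)} (hsec : ∀ x : X, {y : Y | (x, y) ∈ A}.Countable)
    (hD : ∀ z, z ∈ A ↔ (z ∈ D ↔ n % 2 = 0)) (h : Pot (DiffOpen (n + 1)) D) :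
    Pot (DiffOpen n) D := by
  obtain ⟨σ, τ, hσ, hτ, hX, hY, h⟩ := h
  obtain ⟨r, hr, hrn, hrD⟩ := diffOpen_iff_rank.1 h
  have := hX.1
  have := hY.1
  have hsub : {z | r z ≤ 0} ⊆ A := by
    intro z hz
    simp only [mem_ofPred_eq] at hz
    rw [hD, hrD]
    omega
  obtain ⟨σ', τ', hσ', hτ', hX', hY', hc⟩ := exists_isClopen_prod_of_countable_snd_image
    (MeasurableSpace.measurableSet_generateFrom (hr 0))
    (countable_snd_image_of_isOpen (hr 0) fun x => (hsec x).mono fun y hy => hsub hy)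
  have hle : @instTopologicalSpaceProd X Y σ' τ' ≤ @instTopologicalSpaceProd X Y σ τ :=
    inf_le_inf (induced_mono hσ') (induced_mono hτ')
  exact ⟨σ', τ', hσ'.trans hσ, hτ'.trans hτ, hX', hY',
    @diffOpen_of_isClopen_rank_zero _ (@instTopologicalSpaceProd X Y σ' τ') n hn D r
      (fun i => hle _ (hr i)) hrn hrD hc.1⟩

end Potential

theorem mainTheorem7 {X : Type u} {Y : Type v}
    [TopologicalSpace X] [PolishSpace X] [TopologicalSpace Y] [PolishSpace Y]
    (A : Set (X × Y)) (hA : @MeasurableSet (X × Y) (borel (X × Y)) A)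
    (hsec : ∀ x : X, {y : Y | (x, y) ∈ A}.Countable)
    (k : ℕ) (hk : 1 ≤ k) :
    [¬ Pot Delta01 A,
      ¬ Pot Sigma01 A,
      ¬ (Prod.snd '' A).Countable].TFAE ∧
    (IsWadgeSucc.{max u v} (DiffOpen (2 * k - 1)) (DiffOpen (2 * k - 1)).succ ∧
      [¬ Pot (DiffOpen (2 * k - 1)).dual A,
        ¬ Pot (DiffOpen (2 * k)).dual A,
        ¬ Pot (DiffOpen (2 * k - 1)).succ A].TFAE) ∧
    (IsWadgeSucc.{max u v} (DiffOpen (2 * k)) (DiffOpen (2 * k)).succ ∧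
      [¬ Pot (DiffOpen (2 * k + 1)) A,
        ¬ Pot (DiffOpen (2 * k)) A,
        ¬ Pot (DiffOpen (2 * k)).succ A].TFAE) := by
  have hI : ∀ n, (DiffOpen.{max u v} n).Incl (DiffOpen n).succ := fun n =>
    (isWadgeSucc_diffOpen n).2.1.1
  have hId : ∀ n, (DiffOpen.{max u v} n).dual.Incl (DiffOpen n).succ := fun n P t hP A hA =>
    (diffOpen_succ_iff_join n hP A).2 (diffOpen_dual_incl_join n P t hP A hA)
  have hS : ∀ n, (DiffOpen.{max u v} n).succ.Incl (DiffOpen (n + 1)) := fun n P t hP A hA =>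
    ((diffOpen_succ_iff_join n hP A).1 hA).diffOpen_succ
  have hSd : ∀ n, (DiffOpen.{max u v} n).succ.Incl (DiffOpen (n + 1)).dual := fun n P t hP A hA =>
    ((diffOpen_succ_iff_join n hP A).1 hA).compl.diffOpen_succ
  refine ⟨?_, ⟨isWadgeSucc_diffOpen _, ?_⟩, isWadgeSucc_diffOpen _, ?_⟩
  · tfae_have 2 → 1 := mt (Pot.mono fun P t _ A hA => hA.isOpen)
    tfae_have 3 → 2 := by
      refine mt ?_
      rintro ⟨σ, τ, -, -, -, hY, hA'⟩
      have := hY.1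
      exact countable_snd_image_of_isOpen hA' hsec
    tfae_have 1 → 3 := mt fun h => exists_isClopen_prod_of_countable_snd_image hA h
    tfae_finish
  · obtain ⟨m, rfl⟩ : ∃ m, k = m + 1 := ⟨k - 1, by omega⟩
    have e1 : 2 * (m + 1) - 1 = 2 * m + 1 := by omega
    have e2 : 2 * (m + 1) = 2 * m + 1 + 1 := by omega
    rw [e1, e2]
    tfae_have 3 → 1 := mt (Pot.mono (hId _))
    tfae_have 2 → 3 := mt (Pot.mono (hSd _))
    -- Here `n = 2 * m + 1` is odd, so the layer argument applies to `Aᶜ`, whose innermost layer is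
    -- removed and hence lies in `A`.
    tfae_have 1 → 2 := mt fun h => by
      have h' : Pot (DiffOpen (2 * m + 1 + 1)) Aᶜ := h
      exact pot_diffOpen_of_succ (by omega) hsec (fun z => by simp [Nat.add_mod]) h'
    tfae_finish
  · tfae_have 3 → 2 := mt (Pot.mono (hI _))
    tfae_have 1 → 3 := mt (Pot.mono (hS _))
    tfae_have 2 → 1 := mt (pot_diffOpen_of_succ (by omega) hsec (fun z => by simp))
    tfae_finish
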